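/- Let $\mathbb{R}_{\max}=\mathbb{R}\cup\{-\infty\}$, where $ab$ denotes the max-plus product, so $(Ey)_i=\max_j(e_{ij}+y_j)$ and $uy=\max_j(u_j+y_j)$. Let $m,n\ge 0$, $C,D\in\mathbb{R}_{\max}^{m\times(n+1)}$ and $u,v\in\mathbb{R}_{\max}^{n+1}$. The tropical linear-fractional program (homogeneous form) is $$\text{minimize }\lambda\quad\text{subject to}\quad uy\le\lambda+vy,\ \ Cy\le Dy,\ \ y_{n+1}\neq-\infty,\ \ y\in\mathbb{R}_{\max}^{n+1},\ \lambda\in\mathbb{R}_{\max},$$ and its optimal value is the least $\lambda\in\mathbb{R}_{\max}$ for which some $y$ is feasible, if there is one. For $\lambda\in\mathbb{R}$ put $U=\binom{C}{u}$ and $V(\lambda)=\binom{D}{\lambda+v}$, and assume that every column of $U$ and every row of $V(\lambda)$ has a finite entry. Let $\mathcal{G}_\lambda$ be the weighted bipartite digraph with nodes $1,\dots,n+1$ of Min and $1,\dots,m+1$ of Max, an arc of weight $-U_{ij}$ from node $j$ of Min to node $i$ of Max whenever $U_{ij}\ne-\infty$, and an arc of weight $V(\lambda)_{il}$ from node $i$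 of Max to node $l$ of Min whenever $V(\lambda)_{il}\neq-\infty$. A positional strategy of Min is a map $\tau:\{1,\dots,n+1\}\to\{1,\dots,m+1\}$ with $U_{\tau(j)j}\ne-\infty$ for all $j$, and $\mathcal{G}^\tau_\lambda$ is obtained from $\mathcal{G}_\lambda$ by deleting all arcs from a node $j$ of Min to a node $i\ne\tau(j)$ of Max. Let $f_\lambda,f_{\tau,\lambda}:\mathbb{R}^{n+1}\to\mathbb{R}^{n+1}$, $$(f_\lambda(x))_j=\min_{i:\,U_{ij}\neq-\infty}\Bigl(-U_{ij}+\max_l\,(V(\lambda)_{il}+x_l)\Bigr),\qquad (f_{\tau,\lambda}(x))_j=-U_{\tau(j)j}+\max_l\,(V(\lambda)_{\tau(j)l}+x_l),$$ and let $\phi(\lambda)=\lim_{k\to\infty}(f_\lambda^k(x))_{n+1}/k$ and $\phi_\tau(\lambda)=\lim_{k\to\infty}(f_{\tau,\lambda}^k(x))_{n+1}/k$; these limits exist in $\mathbb{R}$ and do not depend on $x\in\mathbb{R}^{n+1}$. A positional strategy $\tau$ of Min is left optimal at $\lambda\in\mathbb{R}$ if for some $\epsilon>0$, $\phi(\mu)=\phi_\tau(\mu)$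 for all $\mu\in[\lambda-\epsilon,\lambda]$. **Theorem.** A real number $\lambda^*$ is the optimal value of the program if and only if $\phi(\lambda^*)\ge0$ and there is a positional strategy $\tau$ of Min such that in the digraph $\mathcal{G}^\tau_{\lambda^*}$ 1. every cycle accessible from node $n+1$ of Min has nonpositive weight, and 2. every cycle of zero weight accessible from node $n+1$ of Min passes through node $m+1$ of Max. Moreover, if $\lambda^*\in\mathbb{R}$ is the optimal value, then every positional strategy $\tau$ of Min that is left optimal at $\lambda^*$ satisfies 1 and 2. -/

import Mathlib

/-! Tropical linear-fractional programming and parametric mean payoff games.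
The max-plus semiring `ℝ ∪ {-∞}` is represented by `WithBot ℝ`: the tropical sum is the maximum,
the tropical product is `+`, with `⊥ + a = a + ⊥ = ⊥`. -/

namespace TropLFP

/-! ### The optimization problem -/

/-- The tropical scalar product `max_j (a_j + y_j)`. -/
def tropDot {n : ℕ} (a y : Fin n → WithBot ℝ) : WithBot ℝ :=
  Finset.univ.sup fun j => a j + y j

/-- The pair `(lam, y)` is feasible for some `y` in the homogeneous problem:
`u y ≤ lam + v y`, `C y ≤ D y`, and the last coordinate of `y` is finite. -/
def Feasible {m n : ℕ} (C D : Matrix (Fin m) (Fin (n + 1)) (WithBot ℝ))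
    (u v : Fin (n + 1) → WithBot ℝ) (lam : WithBot ℝ) : Prop :=
  ∃ y : Fin (n + 1) → WithBot ℝ,
    tropDot u y ≤ lam + tropDot v y ∧
    (∀ i, tropDot (C i) y ≤ tropDot (D i) y) ∧
    y (Fin.last n) ≠ ⊥

/-- `lam` is the optimal value of the problem `minimize lam subject to (lam, y) feasible`,
where `lam` ranges over `ℝ ∪ {-∞}`. -/
def IsOptimalValue {m n : ℕ} (C D : Matrix (Fin m) (Fin (n + 1)) (WithBot ℝ))
    (u v : Fin (n + 1) → WithBot ℝ) (lam : WithBot ℝ) : Prop :=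
  IsLeast {μ : WithBot ℝ | Feasible C D u v μ} lam

/-- The matrix `U`, with the rows of `C` followed by the row `u`. -/
def matU {m n : ℕ} (C : Matrix (Fin m) (Fin (n + 1)) (WithBot ℝ))
    (u : Fin (n + 1) → WithBot ℝ) : Matrix (Fin (m + 1)) (Fin (n + 1)) (WithBot ℝ) :=
  Matrix.of fun i j => Fin.snoc (α := fun _ => WithBot ℝ) (fun i' => C i' j) (u j) i

/-- The matrix `V(lam)`, with the rows of `D` followed by the row `lam + v`. -/
def matV {m n : ℕ} (D : Matrix (Fin m) (Fin (n + 1)) (WithBot ℝ))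
    (v : Fin (n + 1) → WithBot ℝ) (lam : ℝ) :
    Matrix (Fin (m + 1)) (Fin (n + 1)) (WithBot ℝ) :=
  Matrix.of fun i j =>
    Fin.snoc (α := fun _ => WithBot ℝ) (fun i' => D i' j) ((lam : WithBot ℝ) + v j) i

/-! ### Mean payoff games -/

/-- The dynamic programming operator of the game with payment matrices `A`, `B`,
`f_j(x) = min_k (-a_kj + max_l (b_kl + x_l))`. The minimum and the maxima run over the finite
entries, i.e. over the allowed moves; these sets are nonempty as soon as every column of `A` and
every row of `B` has a finite entry, the standing assumption on the game. -/
noncomputable def dynOp {M N : ℕ} (A B : Matrix (Fin M) (Fin N) (WithBot ℝ))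
    (x : Fin N → ℝ) : Fin N → ℝ := fun j =>
  ⨅ k : {k : Fin M // A k j ≠ ⊥},
    (-((A k.1 j).unbotD 0) +
      ⨆ l : {l : Fin N // B k.1 l ≠ ⊥}, ((B k.1 l.1).unbotD 0 + x l.1))

/-- The `j`-th coordinate of the cycle-time vector `lim_k f^k(x) / k`, computed at `x = 0`. -/
noncomputable def cycleTime {N : ℕ} (f : (Fin N → ℝ) → (Fin N → ℝ)) (j : Fin N) : ℝ :=
  Filter.limUnder Filter.atTop fun k : ℕ => (f^[k] 0) j / (k : ℝ)

/-- A positional strategy of player Min: an allowed move at each node of Min. -/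
def IsMinStrategy {M N : ℕ} (A : Matrix (Fin M) (Fin N) (WithBot ℝ)) (τ : Fin N → Fin M) :
    Prop :=
  ∀ j, A (τ j) j ≠ ⊥

/-- The matrix `A_τ`: in column `j` only the entry in row `τ j` is kept. -/
def restrictMin {M N : ℕ} (A : Matrix (Fin M) (Fin N) (WithBot ℝ)) (τ : Fin N → Fin M) :
    Matrix (Fin M) (Fin N) (WithBot ℝ) :=
  Matrix.of fun i j => if i = τ j then A i j else ⊥

/-- The operator of the parametric game with payments `U`, `V(lam)`. -/
noncomputable def specOp {m n : ℕ} (C D : Matrix (Fin m) (Fin (n + 1)) (WithBot ℝ))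
    (u v : Fin (n + 1) → WithBot ℝ) (lam : ℝ) : (Fin (n + 1) → ℝ) → (Fin (n + 1) → ℝ) :=
  dynOp (matU C u) (matV D v lam)

/-- The operator of the parametric game in which Min plays the positional strategy `τ`. -/
noncomputable def specOpMin {m n : ℕ} (C D : Matrix (Fin m) (Fin (n + 1)) (WithBot ℝ))
    (u v : Fin (n + 1) → WithBot ℝ) (τ : Fin (n + 1) → Fin (m + 1)) (lam : ℝ) :
    (Fin (n + 1) → ℝ) → (Fin (n + 1) → ℝ) :=
  dynOp (restrictMin (matU C u) τ) (matV D v lam)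

/-- The spectral function `φ`. -/
noncomputable def specFun {m n : ℕ} (C D : Matrix (Fin m) (Fin (n + 1)) (WithBot ℝ))
    (u v : Fin (n + 1) → WithBot ℝ) (lam : ℝ) : ℝ :=
  cycleTime (specOp C D u v lam) (Fin.last n)

/-- The partial spectral function `φ_τ` of a strategy `τ` of Min. -/
noncomputable def specFunMin {m n : ℕ} (C D : Matrix (Fin m) (Fin (n + 1)) (WithBot ℝ))
    (u v : Fin (n + 1) → WithBot ℝ) (τ : Fin (n + 1) → Fin (m + 1)) (lam : ℝ) : ℝ :=
  cycleTime (specOpMin C D u v τ lam) (Fin.last n)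

/-- The strategy `τ` of Min is left optimal at `lam`. -/
def IsLeftOptimal {m n : ℕ} (C D : Matrix (Fin m) (Fin (n + 1)) (WithBot ℝ))
    (u v : Fin (n + 1) → WithBot ℝ) (τ : Fin (n + 1) → Fin (m + 1)) (lam : ℝ) : Prop :=
  ∃ ε : ℝ, 0 < ε ∧ ∀ μ ∈ Set.Icc (lam - ε) lam,
    specFun C D u v μ = specFunMin C D u v τ μ

/-! ### Digraphs -/

/-- The weighted bipartite digraph of the game with payment matrices `A`, `B`. The nodes of Min
are `Sum.inl j`, the nodes of Max are `Sum.inr i`; the weight `⊥` means that there is no arc. -/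
def gameDigraph {M N : ℕ} (A B : Matrix (Fin M) (Fin N) (WithBot ℝ)) :
    Fin N ⊕ Fin M → Fin N ⊕ Fin M → WithBot ℝ
  | Sum.inl j, Sum.inr i => (A i j).map fun a : ℝ => -a
  | Sum.inr i, Sum.inl l => B i l
  | Sum.inl _, Sum.inl _ => ⊥
  | Sum.inr _, Sum.inr _ => ⊥

/-- The digraph `G^τ_lam`: the digraph of the game with payments `U`, `V(lam)`, in which the only
arc that leaves node `j` of Min is the one to node `τ j` of Max. -/
def strategyDigraph {m n : ℕ} (C D : Matrix (Fin m) (Fin (n + 1)) (WithBot ℝ))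
    (u v : Fin (n + 1) → WithBot ℝ) (τ : Fin (n + 1) → Fin (m + 1)) (lam : ℝ) :
    Fin (n + 1) ⊕ Fin (m + 1) → Fin (n + 1) ⊕ Fin (m + 1) → WithBot ℝ :=
  gameDigraph (restrictMin (matU C u) τ) (matV D v lam)

/-- The nodes `x 0, …, x (k - 1), x k = x 0` form a cycle with `k ≥ 1` arcs
(repeated nodes are allowed). -/
def IsCycle {V : Type*} (w : V → V → WithBot ℝ) (k : ℕ) (x : ℕ → V) : Prop :=
  1 ≤ k ∧ x k = x 0 ∧ ∀ t < k, w (x t) (x (t + 1)) ≠ ⊥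

/-- The total weight of the arcs of a cycle. -/
def cycleWeight {V : Type*} (w : V → V → WithBot ℝ) (k : ℕ) (x : ℕ → V) : ℝ :=
  ∑ t ∈ Finset.range k, (w (x t) (x (t + 1))).unbotD 0

/-- There is a directed path (possibly of length zero) from `a` to `b`. -/
def Accesses {V : Type*} (w : V → V → WithBot ℝ) (a b : V) : Prop :=
  Relation.ReflTransGen (fun y z => w y z ≠ ⊥) a b

/-- The two conditions on `G^τ_lam`: every cycle accessible from the last node of Min has
nonpositive weight, and if its weight is zero, it passes through the last node of Max. -/
def Certificate {m n : ℕ} (C D : Matrix (Fin m) (Fin (n + 1)) (WithBot ℝ))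
    (u v : Fin (n + 1) → WithBot ℝ) (τ : Fin (n + 1) → Fin (m + 1)) (lam : ℝ) : Prop :=
  let w := strategyDigraph C D u v τ lam
  (∀ k x, IsCycle w k x → Accesses w (Sum.inl (Fin.last n)) (x 0) → cycleWeight w k x ≤ 0) ∧
  (∀ k x, IsCycle w k x → Accesses w (Sum.inl (Fin.last n)) (x 0) → cycleWeight w k x = 0 →
    ∃ t < k, x t = Sum.inr (Fin.last m))

end TropLFP

/-!
The proof rests on a theorem of the alternative, `game_alternative`: for every threshold `r`, either
the tropical system `A y + r ≤ B y` has a solution with `y_{j₀}` finite, or Min has a positional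
strategy `τ` against which every positional choice of Max earns at most `r - δ` per round from `j₀`,
for some `δ > 0`, as witnessed by a potential.

The reason is `exists_common_solution`. Consider constraints indexed by a coordinate `j` and an
option `i`, each preserved when a constant is added to `y` and when `y` increases while `y_j` is
kept. Such systems are determined one coordinate at a time: if each option at `j` has a solution,
either one of these is `⊥` at `j`, and then satisfies every constraint at `j`, or all can be
normalized to vanish at `j`, and then their supremum satisfies all constraints at `j`. Applied to
the options of Min this produces an infeasible positional strategy `τ` when the whole system is
infeasible. Against each positional reply of Max the game follows the orbit of a self-map of a
finite set, which ends in a cycle or leaves the graph, and `map_alternative` gives a potential.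
Applied again, now to the options of Max and to the reversed inequalities, `exists_common_solution`
merges these potentials into one.

A solution of the system bounds the orbits of the dynamic programming operator from below by
`r k + O(1)`, a potential bounds them from above by `(r - δ) k + O(1)`. Hence the limit of
`f^k(x)_{j₀} / k` exists and is the supremum of the feasible `r`; by the strict gap `δ` it is
nonnegative exactly when `r = 0` is feasible (`cycleTime_nonneg_iff`), so that `φ(λ) ≥ 0` means that
`λ` is feasible. A potential with negative bound makes all accessible cycles negative, whereas a
feasible `y` produces an accessible cycle of nonnegative weight in the digraph of every strategy.

Finally, the weight of a cycle of `G^τ_μ` is affine in `μ`, with slope the number of passages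
through the last node of Max. Thus the two conditions at `λ` hold if and only if all accessible cycles of
`G^τ_μ` are negative for `μ < λ` arbitrarily close to `λ`, and then for all `μ < λ`
(`Certificate.negativeCycles`, `certificate_of_frequently`). When `λ` is optimal, each `μ < λ` is
infeasible and so has such a strategy `τ`; finiteness of the set of strategies allows a single one.
-/

namespace TropLFP

/-! ### Systems of tropical inequalities -/

/-- Determinacy in positional strategies. The constraints `R j i` are indexed by a coordinate `j`
and an option `i`. If every choice of one option per coordinate admits a solution that is finite at
`j₀`, then so does the system of all constraints. -/
theorem exists_common_solution {V ι : Type*} [Finite V] [Finite ι] [Nonempty ι]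
    (R : V → ι → (V → WithBot ℝ) → Prop)
    (hbot : ∀ j i y, y j = ⊥ → R j i y)
    (hshift : ∀ j i y (c : ℝ), R j i y → R j i fun l => y l + (c : WithBot ℝ))
    (hmono : ∀ j i y y', (∀ l, y l ≤ y' l) → y' j = y j → R j i y → R j i y')
    (j₀ : V) (h : ∀ τ : V → ι, ∃ y : V → WithBot ℝ, y j₀ ≠ ⊥ ∧ ∀ j, R j (τ j) y) :
    ∃ y : V → WithBot ℝ, y j₀ ≠ ⊥ ∧ ∀ j i, R j i y := by
  classical
  have := Fintype.ofFinite V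
  have := Fintype.ofFinite ι
  -- By induction on `S`, all options can be imposed on the coordinates in `S`, together with the
  -- options chosen by `τ` elsewhere.
  have key : ∀ S : Finset V, ∀ τ : V → ι, ∃ y : V → WithBot ℝ, y j₀ ≠ ⊥ ∧
      ∀ j, R j (τ j) y ∧ (j ∈ S → ∀ i, R j i y) := by
    intro S
    induction S using Finset.induction_on with
    | empty => exact fun τ => (h τ).imp fun y hy => ⟨hy.1, fun j => ⟨hy.2 j, by simp⟩⟩
    | insert j₁ S _ ih =>
      intro τ
      choose y hy0 hy using fun i => ih (Function.update τ j₁ i)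
      by_cases hex : ∃ i, y i j₁ = ⊥
      · obtain ⟨i, hi⟩ := hex
        refine ⟨y i, hy0 i, fun j => ?_⟩
        by_cases hj : j = j₁
        · subst hj
          exact ⟨hbot _ _ _ hi, fun _ _ => hbot _ _ _ hi⟩
        · have := hy i j
          rw [Function.update_of_ne hj] at this
          exact ⟨this.1, fun hm => this.2 (Finset.mem_of_mem_insert_of_ne hm hj)⟩
      · push Not at hex
        choose c hc using fun i => WithBot.ne_bot_iff_exists.1 (hex i)
        -- Each solution is normalized to vanish at `j₁`.
        set z : ι → V → WithBot ℝ := fun i l => y i l + ((-c i : ℝ) : WithBot ℝ) with hz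
        have hz1 : ∀ i, z i j₁ = 0 := by
          intro i
          simp only [hz, ← hc i]
          rw [← WithBot.coe_add, add_neg_cancel]; rfl
        have hzR : ∀ i j i', R j i' (y i) → R j i' (z i) := fun i j i' hR =>
          hshift _ _ _ _ hR
        let Y : V → WithBot ℝ := fun l => Finset.univ.sup fun i => z i l
        have hle : ∀ i l, z i l ≤ Y l := fun i l =>
          Finset.le_sup (f := fun i => z i l) (Finset.mem_univ i)
        have hY1 : Y j₁ = 0 := by
          simp only [Y, hz1]
          exact Finset.sup_const Finset.univ_nonempty _
        have hYat : ∀ l, ∃ i, Y l = z i l := fun l => by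
          obtain ⟨i, -, hi⟩ := Finset.exists_mem_eq_sup Finset.univ Finset.univ_nonempty
            (fun i => z i l)
          exact ⟨i, hi⟩
        refine ⟨Y, ?_, fun j => ?_⟩
        · obtain ⟨i⟩ := ‹Nonempty ι›
          intro hb
          have h1 : z i j₀ = ⊥ := le_bot_iff.1 (hb ▸ hle i j₀)
          exact hy0 i (by simpa [hz] using h1)
        · by_cases hj : j = j₁
          · subst hj
            have hall : ∀ i, R j i Y := fun i =>
              hmono j i (z i) Y (hle i) (by rw [hY1, hz1])
                (hzR i j i (by simpa using (hy i j).1))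
            exact ⟨hall _, fun _ => hall⟩
          · obtain ⟨i, hi⟩ := hYat j
            have hR := hy i j
            rw [Function.update_of_ne hj] at hR
            exact ⟨hmono j _ (z i) Y (hle i) hi (hzR i j _ hR.1), fun hm i' =>
              hmono j _ (z i) Y (hle i) hi
                (hzR i j _ (hR.2 (Finset.mem_of_mem_insert_of_ne hm hj) i'))⟩
  obtain ⟨i⟩ := ‹Nonempty ι›
  obtain ⟨y, hy0, hy⟩ := key Finset.univ fun _ => i
  exact ⟨y, hy0, fun j => (hy j).2 (Finset.mem_univ j)⟩

/-- The least function with values in `ℝ ∪ {-∞}` that is at least `s t` at `x t` for all `t < T`. -/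
theorem exists_upper_envelope {V : Type*} (x : ℕ → V) (s : ℕ → ℝ) (T : ℕ) :
    ∃ y : V → WithBot ℝ, (∀ t < T, (s t : WithBot ℝ) ≤ y (x t)) ∧
      ∀ j, y j = ⊥ ∨ ∃ t < T, x t = j ∧ y j = s t := by
  classical
  refine ⟨fun j => ((Finset.range T).filter fun t => x t = j).sup fun t => (s t : WithBot ℝ),
    fun t ht => ?_, fun j => ?_⟩
  · exact Finset.le_sup (f := fun t => (s t : WithBot ℝ)) (by simp [ht])
  · rcases ((Finset.range T).filter fun t => x t = j).eq_empty_or_nonempty with h | h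
    · left; simp only [h, Finset.sup_empty]
    · obtain ⟨t, ht, hs⟩ := Finset.exists_mem_eq_sup _ h fun t => (s t : WithBot ℝ)
      rw [Finset.mem_filter, Finset.mem_range] at ht
      exact Or.inr ⟨t, ht.1, ht.2, hs⟩

/-- The envelope of the partial sums of `e` along an orbit satisfies all inequalities except the one
at the node where the orbit is stopped. -/
theorem exists_potential_of_dead_end {V : Type*} (h : V → V) (e : V → ℝ) (j₀ : V) (T : ℕ) :
    ∃ y : V → WithBot ℝ, y j₀ ≠ ⊥ ∧ ∀ j, j ≠ h^[T] j₀ → y j + (e j : WithBot ℝ) ≤ y (h j) := by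
  obtain ⟨y, hy, hy'⟩ := exists_upper_envelope (fun t => h^[t] j₀)
    (fun t => ∑ i ∈ Finset.range t, e (h^[i] j₀)) (T + 1)
  refine ⟨y, fun hb => ?_, fun j hj => ?_⟩
  · have := hy 0 (by omega)
    simp [hb] at this
  · rcases hy' j with hb | ⟨t, ht, rfl, hs⟩
    · simp [hb]
    · have hne : t ≠ T := fun h' => hj (by rw [h'])
      have := hy (t + 1) (by omega)
      rw [Finset.sum_range_succ, Function.iterate_succ_apply'] at this
      rw [hs, ← WithBot.coe_add]
      exact this

/-- When the sum of `e` over the cycle of an orbit is nonpositive, the envelope of its partial sums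
up to the closing of the cycle satisfies all inequalities. -/
theorem exists_potential_of_cycle {V : Type*} (h : V → V) (e : V → ℝ) (j₀ : V) {p q : ℕ}
    (hpq : p < q) (hper : h^[p] j₀ = h^[q] j₀)
    (hsum : ∑ i ∈ Finset.range q, e (h^[i] j₀) ≤ ∑ i ∈ Finset.range p, e (h^[i] j₀)) :
    ∃ y : V → WithBot ℝ, y j₀ ≠ ⊥ ∧
      ∀ j, y j = ⊥ ∨ ((∃ t, h^[t] j₀ = j) ∧ y j + (e j : WithBot ℝ) ≤ y (h j)) := by
  obtain ⟨y, hy, hy'⟩ := exists_upper_envelope (fun t => h^[t] j₀)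
    (fun t => ∑ i ∈ Finset.range t, e (h^[i] j₀)) q
  refine ⟨y, fun hb => ?_, fun j => ?_⟩
  · have := hy 0 (by omega)
    simp [hb] at this
  · rcases hy' j with hb | ⟨t, ht, rfl, hs⟩
    · exact Or.inl hb
    · refine Or.inr ⟨⟨t, rfl⟩, ?_⟩
      rw [hs, ← WithBot.coe_add, ← Function.iterate_succ_apply' h,
        ← Finset.sum_range_succ (fun i => e (h^[i] j₀))]
      rcases Nat.lt_or_ge (t + 1) q with hlt | hge
      · exact hy (t + 1) hlt
      · have hq : t + 1 = q := by omega
        rw [Nat.succ_eq_add_one, hq, ← hper]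
        exact (WithBot.coe_le_coe.2 hsum).trans (hy p hpq)

/-- The alternative when both players have fixed positional strategies: the move from `j` leads to
`h j` and pays `b j - a j`, where `b j = ⊥` means that Max has chosen a forbidden move. Either the
payments along the orbit of `j₀` support the rate `r`, or they stay below a rate `r - δ`. -/
theorem map_alternative {V : Type*} [Finite V] (h : V → V) (a : V → ℝ) (b : V → WithBot ℝ)
    (r : ℝ) (j₀ : V) :
    (∃ y : V → WithBot ℝ, y j₀ ≠ ⊥ ∧ ∀ j, (a j : WithBot ℝ) + y j + r ≤ b j + y (h j)) ∨
    ∃ δ : ℝ, 0 < δ ∧ ∃ y : V → WithBot ℝ, y j₀ ≠ ⊥ ∧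
      ∀ j, y j + b j ≤ (a j : WithBot ℝ) + ((r - δ : ℝ) : WithBot ℝ) + y (h j) := by
  by_cases hb : ∃ t, b (h^[t] j₀) = ⊥
  · right
    obtain ⟨T, hT⟩ := hb
    obtain ⟨y, hy0, hy⟩ := exists_potential_of_dead_end h
      (fun j => (b j).unbotD 0 - a j - (r - 1)) j₀ T
    refine ⟨1, one_pos, y, hy0, fun j => ?_⟩
    by_cases hj : j = h^[T] j₀
    · simp [hj, hT]
    · have := hy j hj
      revert this
      cases b j with
      | bot => simp
      | coe β =>
        cases y j with
        | bot => simp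
        | coe η =>
          cases y (h j) with
          | bot => intro h'; rw [← WithBot.coe_add] at h'; simp at h'
          | coe ζ => intro h'; norm_cast at h' ⊢; simp at h'; linarith
  · push Not at hb
    obtain ⟨p, q, hpq, hper⟩ : ∃ p q, p < q ∧ h^[p] j₀ = h^[q] j₀ := by
      obtain ⟨p, q, hne, heq⟩ := Finite.exists_ne_map_eq_of_infinite fun t : ℕ => h^[t] j₀
      rcases hne.lt_or_gt with hlt | hlt
      · exact ⟨p, q, hlt, heq⟩
      · exact ⟨q, p, hlt, heq.symm⟩
    let e : V → ℝ := fun j => a j + r - (b j).unbotD 0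
    rcases le_or_gt (∑ i ∈ Finset.range q, e (h^[i] j₀)) (∑ i ∈ Finset.range p, e (h^[i] j₀))
      with hle | hgt
    · left
      obtain ⟨y, hy0, hy⟩ := exists_potential_of_cycle h e j₀ hpq hper hle
      refine ⟨y, hy0, fun j => ?_⟩
      rcases hy j with hj | ⟨⟨t, rfl⟩, hj⟩
      · simp [hj]
      · have := hb t
        revert this hj
        simp only [e]
        cases b (h^[t] j₀) with
        | bot => simp
        | coe β =>
          cases y (h^[t] j₀) with
          | bot => simp
          | coe η =>
            cases y (h (h^[t] j₀)) with
            | bot => intro h'; rw [← WithBot.coe_add] at h'; simp at h'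
            | coe ζ => intro h' _; norm_cast at h' ⊢; simp at h'; linarith
    · right
      have hqp : (0 : ℝ) < (q : ℝ) - p := sub_pos.2 (by exact_mod_cast hpq)
      -- The slack of the cycle is distributed evenly over its arcs.
      let δ : ℝ := (∑ i ∈ Finset.range q, e (h^[i] j₀) -
        ∑ i ∈ Finset.range p, e (h^[i] j₀)) / ((q : ℝ) - p)
      have hδ : 0 < δ := div_pos (sub_pos.2 hgt) hqp
      have hδ' : δ * ((q : ℝ) - p) = ∑ i ∈ Finset.range q, e (h^[i] j₀) -
          ∑ i ∈ Finset.range p, e (h^[i] j₀) := div_mul_cancel₀ _ hqp.ne'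
      obtain ⟨y, hy0, hy⟩ := exists_potential_of_cycle h (fun j => δ - e j) j₀ hpq hper (by
        simp only [Finset.sum_sub_distrib, Finset.sum_const, Finset.card_range, nsmul_eq_mul]
        linarith)
      refine ⟨δ, hδ, y, hy0, fun j => ?_⟩
      rcases hy j with hj | ⟨⟨t, rfl⟩, hj⟩
      · simp [hj]
      · have := hb t
        revert this hj
        simp only [e]
        cases b (h^[t] j₀) with
        | bot => simp
        | coe β =>
          cases y (h^[t] j₀) with
          | bot => simp
          | coe η =>
            cases y (h (h^[t] j₀)) with
            | bot => intro h'; rw [← WithBot.coe_add] at h'; simp at h'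
            | coe ζ => intro h' _; norm_cast at h' ⊢; simp at h'; linarith

/-! ### The tropical scalar product -/

theorem tropDot_mono {n : ℕ} (a : Fin n → WithBot ℝ) {y y' : Fin n → WithBot ℝ}
    (h : ∀ l, y l ≤ y' l) : tropDot a y ≤ tropDot a y' :=
  Finset.sup_mono_fun fun l _ => by gcongr; exact h l

theorem le_tropDot {n : ℕ} (a y : Fin n → WithBot ℝ) (l : Fin n) : a l + y l ≤ tropDot a y :=
  Finset.le_sup (f := fun j => a j + y j) (Finset.mem_univ l)

theorem exists_tropDot_eq {n : ℕ} [NeZero n] (a y : Fin n → WithBot ℝ) :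
    ∃ l, tropDot a y = a l + y l := by
  obtain ⟨l, -, hl⟩ := Finset.exists_mem_eq_sup Finset.univ ⟨0, Finset.mem_univ _⟩
    (fun j => a j + y j)
  exact ⟨l, hl⟩

theorem tropDot_add_const {n : ℕ} (a y : Fin n → WithBot ℝ) (c : WithBot ℝ) :
    tropDot a (fun l => y l + c) = tropDot a y + c := by
  unfold tropDot
  rw [Finset.apply_sup_eq_sup_comp (fun x : WithBot ℝ => x + c)]
  · simp [Function.comp_def, add_assoc]
  · exact fun x y => (max_add_add_right x y c).symm
  · simp

theorem tropDot_le_iff {n : ℕ} {a y : Fin n → WithBot ℝ} {c : WithBot ℝ} :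
    tropDot a y ≤ c ↔ ∀ l, a l + y l ≤ c := by
  simp [tropDot]

theorem tropDot_const_add {n : ℕ} (c : WithBot ℝ) (a y : Fin n → WithBot ℝ) :
    tropDot (fun l => c + a l) y = c + tropDot a y := by
  have h := tropDot_add_const y a c
  simp only [tropDot, add_comm] at h ⊢
  exact h

/-! ### The theorem of the alternative for games -/

/-- The tropical system `A y + r ≤ B y` has a solution whose `j₀`-th coordinate is finite. -/
def PrimalFeasible {M N : ℕ} (A B : Matrix (Fin M) (Fin N) (WithBot ℝ)) (r : ℝ) (j₀ : Fin N) :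
    Prop :=
  ∃ y : Fin N → WithBot ℝ, y j₀ ≠ ⊥ ∧ ∀ j i, A i j + y j + (r : WithBot ℝ) ≤ tropDot (B i) y

/-- The game in which Min plays `τ` has a potential that bounds the payment of each round by `s`.
The potential is `-y`, so that the value `⊥` of `y` stands for `+∞`. -/
def DualFeasible {M N : ℕ} (A B : Matrix (Fin M) (Fin N) (WithBot ℝ)) (τ : Fin N → Fin M)
    (s : ℝ) (j₀ : Fin N) : Prop :=
  ∃ y : Fin N → WithBot ℝ, y j₀ ≠ ⊥ ∧
    ∀ j l, y j + B (τ j) l ≤ A (τ j) j + (s : WithBot ℝ) + y l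

/-- If `A y + r ≤ B y` has no solution finite at `j₀`, Min has a positional strategy which keeps the
payment per round below a rate strictly less than `r`. -/
theorem game_alternative {M N : ℕ} {A B : Matrix (Fin M) (Fin N) (WithBot ℝ)}
    (hA : ∀ j, ∃ i, A i j ≠ ⊥) (r : ℝ) (j₀ : Fin N) (hp : ¬ PrimalFeasible A B r j₀) :
    ∃ τ, IsMinStrategy A τ ∧ ∃ δ : ℝ, 0 < δ ∧ DualFeasible A B τ (r - δ) j₀ := by
  classical
  have : Nonempty (Fin M) := ⟨(hA j₀).choose⟩
  have : Nonempty (Fin N) := ⟨j₀⟩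
  -- Min has a positional strategy that already makes the system infeasible.
  obtain ⟨τ, hτ, hinf⟩ : ∃ τ, IsMinStrategy A τ ∧ ¬ ∃ y : Fin N → WithBot ℝ, y j₀ ≠ ⊥ ∧
      ∀ j, A (τ j) j + y j + (r : WithBot ℝ) ≤ tropDot (B (τ j)) y := by
    by_contra hcon
    push Not at hcon
    refine hp (exists_common_solution
      (fun j i y => A i j + y j + (r : WithBot ℝ) ≤ tropDot (B i) y) ?_ ?_ ?_ j₀ ?_)
    · intro j i y hy; simp [hy]
    · intro j i y c hy
      simp only [tropDot_add_const]
      calc A i j + (y j + c) + r = A i j + y j + r + c := by ac_rfl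
        _ ≤ _ := by gcongr
    · intro j i y y' hle hj hy
      simp only [hj]
      exact hy.trans (tropDot_mono _ hle)
    · intro τ
      -- Forbidden moves impose no constraint, so they may be replaced by arbitrary allowed ones.
      choose κ hκ using hA
      obtain ⟨y, hy0, hy⟩ := hcon (fun j => if A (τ j) j = ⊥ then κ j else τ j) (by
        intro j
        by_cases hj : A (τ j) j = ⊥
        · simp only [hj, if_true]; exact hκ j
        · simp only [hj, if_false]; exact hj)
      refine ⟨y, hy0, fun j => ?_⟩
      by_cases hj : A (τ j) j = ⊥
      · simp [hj]
      · have := hy j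
        simp only [hj, if_false] at this
        exact this
  choose a ha using fun j => WithBot.ne_bot_iff_exists.1 (hτ j)
  have hg : ∀ g : Fin N → Fin N, ∃ δ : ℝ, 0 < δ ∧ ∃ y : Fin N → WithBot ℝ, y j₀ ≠ ⊥ ∧
      ∀ j, y j + B (τ j) (g j) ≤ (a j : WithBot ℝ) + ((r - δ : ℝ) : WithBot ℝ) + y (g j) := by
    intro g
    refine (map_alternative g a (fun j => B (τ j) (g j)) r j₀).resolve_left ?_
    rintro ⟨y, hy0, hy⟩
    exact hinf ⟨y, hy0, fun j => by rw [← ha]; exact (hy j).trans (le_tropDot _ _ _)⟩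
  choose δ hδ hy using hg
  obtain ⟨g₀, hg₀⟩ := Finite.exists_min δ
  refine ⟨τ, hτ, δ g₀, hδ g₀, exists_common_solution
    (fun j l y => y j + B (τ j) l ≤ A (τ j) j + ((r - δ g₀ : ℝ) : WithBot ℝ) + y l)
    ?_ ?_ ?_ j₀ ?_⟩
  · intro j i y hy; simp [hy]
  · intro j l y c hy
    calc y j + c + B (τ j) l = y j + B (τ j) l + c := by ac_rfl
      _ ≤ A (τ j) j + ((r - δ g₀ : ℝ) : WithBot ℝ) + y l + c := by gcongr
      _ = A (τ j) j + ((r - δ g₀ : ℝ) : WithBot ℝ) + (y l + c) := by ac_rfl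
  · intro j l y y' hle hj hy
    simp only [hj]
    exact hy.trans (by gcongr; exact hle l)
  · intro g
    obtain ⟨y, hy0, hy⟩ := hy g
    refine ⟨y, hy0, fun j => (hy j).trans ?_⟩
    rw [← ha]
    gcongr
    exact WithBot.coe_le_coe.2 (sub_le_sub_left (hg₀ g) r)

/-! ### Growth of the orbits of the dynamic programming operator -/

section Growth

variable {M N : ℕ} {A B : Matrix (Fin M) (Fin N) (WithBot ℝ)}

theorem exists_le_of_ne_bot (y : Fin N → WithBot ℝ) (x : Fin N → ℝ) :
    ∃ c : ℝ, ∀ j, y j + (c : WithBot ℝ) ≤ x j := by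
  obtain ⟨c, hc⟩ := (Set.finite_range fun j => x j - (y j).unbotD 0).bddBelow
  refine ⟨c, fun j => ?_⟩
  have := hc (Set.mem_range_self j)
  revert this
  cases y j with
  | bot => simp
  | coe η => intro h; norm_cast; simp at h; linarith

theorem dynOp_le {k : Fin M} {j : Fin N} (hk : A k j ≠ ⊥) (x : Fin N → ℝ) :
    dynOp A B x j ≤ -((A k j).unbotD 0) +
      ⨆ l : {l : Fin N // B k l ≠ ⊥}, ((B k l.1).unbotD 0 + x l.1) :=
  ciInf_le (Set.finite_range _).bddBelow (⟨k, hk⟩ : {k : Fin M // A k j ≠ ⊥})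

theorem le_dynOp_of_primal [NeZero N] (hA : ∀ j, ∃ i, A i j ≠ ⊥) {r c : ℝ}
    {y : Fin N → WithBot ℝ} (hy : ∀ j i, A i j + y j + (r : WithBot ℝ) ≤ tropDot (B i) y)
    {x : Fin N → ℝ} (hx : ∀ j, y j + (c : WithBot ℝ) ≤ x j) (j : Fin N) :
    y j + ((c + r : ℝ) : WithBot ℝ) ≤ dynOp A B x j := by
  rcases hj : y j with _ | η
  · exact bot_le
  · change (η : WithBot ℝ) + ((c + r : ℝ) : WithBot ℝ) ≤ _
    norm_cast
    have : Nonempty {k : Fin M // A k j ≠ ⊥} := by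
      obtain ⟨i, hi⟩ := hA j
      exact ⟨⟨i, hi⟩⟩
    refine le_ciInf fun k => ?_
    obtain ⟨k, hk⟩ := k
    obtain ⟨a, ha⟩ := WithBot.ne_bot_iff_exists.1 hk
    obtain ⟨l, hl⟩ := exists_tropDot_eq (B k) y
    have h1 := hy j k
    have h2 := hx l
    change y j = (η : WithBot ℝ) at hj
    rw [hl, hj, ← ha] at h1
    have hb : B k l ≠ ⊥ := by
      intro hb
      rw [hb, WithBot.bot_add, ← WithBot.coe_add, ← WithBot.coe_add] at h1
      simp at h1
    have hyl : y l ≠ ⊥ := by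
      intro hb
      rw [hb, WithBot.add_bot, ← WithBot.coe_add, ← WithBot.coe_add] at h1
      simp at h1
    have h3 := le_ciSup (f := fun l : {l : Fin N // B k l ≠ ⊥} => (B k l.1).unbotD 0 + x l.1)
      (Set.finite_range _).bddAbove ⟨l, hb⟩
    obtain ⟨b, hb'⟩ := WithBot.ne_bot_iff_exists.1 hb
    obtain ⟨ζ, hζ⟩ := WithBot.ne_bot_iff_exists.1 hyl
    rw [← hb', ← hζ] at h1
    rw [← hζ] at h2
    simp only [← hb', ← ha, WithBot.unbotD_coe] at h3 ⊢
    norm_cast at h1 h2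
    linarith

theorem dynOp_le_of_dual (hB : ∀ i, ∃ l, B i l ≠ ⊥) {τ : Fin N → Fin M}
    (hτ : IsMinStrategy A τ) {s c : ℝ} {y : Fin N → WithBot ℝ}
    (hy : ∀ j l, y j + B (τ j) l ≤ A (τ j) j + (s : WithBot ℝ) + y l)
    {x : Fin N → ℝ} (hx : ∀ j, y j + x j ≤ (c : WithBot ℝ)) (j : Fin N) :
    y j + (dynOp A B x j : WithBot ℝ) ≤ ((c + s : ℝ) : WithBot ℝ) := by
  rcases hj : y j with _ | η
  · exact bot_le
  · change (η : WithBot ℝ) + _ ≤ _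
    change y j = (η : WithBot ℝ) at hj
    obtain ⟨a, ha⟩ := WithBot.ne_bot_iff_exists.1 (hτ j)
    have : Nonempty {l : Fin N // B (τ j) l ≠ ⊥} := by
      obtain ⟨i, hi⟩ := hB (τ j)
      exact ⟨⟨i, hi⟩⟩
    have h1 := dynOp_le (B := B) (hτ j) x
    have h2 : (⨆ l : {l : Fin N // B (τ j) l ≠ ⊥}, ((B (τ j) l.1).unbotD 0 + x l.1)) ≤
        c + s + a - η := by
      refine ciSup_le fun l => ?_
      obtain ⟨l, hl⟩ := l
      have h3 := hy j l
      have h4 := hx l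
      obtain ⟨b, hb⟩ := WithBot.ne_bot_iff_exists.1 hl
      rw [hj, ← ha, ← hb] at h3
      simp only [← hb, WithBot.unbotD_coe]
      revert h4 h3
      cases y l with
      | bot =>
        intro _ h3
        rw [WithBot.add_bot, ← WithBot.coe_add] at h3
        simp at h3
      | coe ζ =>
        intro h4 h3
        norm_cast at h3 h4
        linarith
    rw [← ha, WithBot.unbotD_coe] at h1
    norm_cast
    linarith

/-- A solution of `A y + r ≤ B y` is, up to constants, a lower bound that the operator raises by at
least `r` at each step. -/
theorem PrimalFeasible.exists_le_iterate [NeZero N] (hA : ∀ j, ∃ i, A i j ≠ ⊥) {r : ℝ}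
    {j₀ : Fin N} (hp : PrimalFeasible A B r j₀) (x : Fin N → ℝ) :
    ∃ c : ℝ, ∀ k : ℕ, k * r + c ≤ ((dynOp A B)^[k] x) j₀ := by
  obtain ⟨y, hy0, hy⟩ := hp
  obtain ⟨c, hc⟩ := exists_le_of_ne_bot y x
  have key : ∀ k : ℕ, ∀ j, y j + ((c + k * r : ℝ) : WithBot ℝ) ≤ ((dynOp A B)^[k] x) j := by
    intro k
    induction k with
    | zero => simpa using hc
    | succ k ih =>
      intro j
      rw [Function.iterate_succ_apply']
      convert le_dynOp_of_primal hA hy ih j using 3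
      push_cast; ring
  obtain ⟨η, hη⟩ := WithBot.ne_bot_iff_exists.1 hy0
  refine ⟨η + c, fun k => ?_⟩
  have := key k j₀
  rw [← hη] at this
  norm_cast at this
  linarith

/-- A potential is, up to constants, an upper bound that the operator raises by at most `s` at each
step. -/
theorem DualFeasible.exists_iterate_le (hB : ∀ i, ∃ l, B i l ≠ ⊥) {τ : Fin N → Fin M}
    (hτ : IsMinStrategy A τ) {s : ℝ} {j₀ : Fin N} (hd : DualFeasible A B τ s j₀)
    (x : Fin N → ℝ) : ∃ c : ℝ, ∀ k : ℕ, ((dynOp A B)^[k] x) j₀ ≤ k * s + c := by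
  obtain ⟨y, hy0, hy⟩ := hd
  obtain ⟨c, hc⟩ := exists_le_of_ne_bot y (-x)
  have key : ∀ k : ℕ, ∀ j,
      y j + (((dynOp A B)^[k] x) j : WithBot ℝ) ≤ ((-c + k * s : ℝ) : WithBot ℝ) := by
    intro k
    induction k with
    | zero =>
      intro j
      have := hc j
      revert this
      simp only [Function.iterate_zero, id_eq, Pi.neg_apply]
      cases y j with
      | bot => simp
      | coe η => intro h; norm_cast at h ⊢; simp; linarith
    | succ k ih =>
      intro j
      rw [Function.iterate_succ_apply']
      convert dynOp_le_of_dual hB hτ hy ih j using 2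
      push_cast; ring
  obtain ⟨η, hη⟩ := WithBot.ne_bot_iff_exists.1 hy0
  refine ⟨-c - η, fun k => ?_⟩
  have := key k j₀
  rw [← hη] at this
  norm_cast at this
  linarith

theorem exists_primalFeasible (hB : ∀ i, ∃ l, B i l ≠ ⊥) (j₀ : Fin N) :
    ∃ r, PrimalFeasible A B r j₀ := by
  choose g hg using hB
  obtain ⟨r, hr⟩ := (Set.finite_range fun p : Fin M × Fin N =>
    (B p.1 (g p.1)).unbotD 0 - (A p.1 p.2).unbotD 0).bddBelow
  refine ⟨r, fun _ => 0, by simp, fun j i => ?_⟩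
  refine le_trans ?_ (le_tropDot _ _ (g i))
  have := hr (Set.mem_range_self (i, j))
  obtain ⟨b, hb⟩ := WithBot.ne_bot_iff_exists.1 (hg i)
  revert this
  rw [add_zero, add_zero]
  simp only [← hb, WithBot.unbotD_coe]
  cases A i j with
  | bot => simp
  | coe a => intro h; norm_cast; simp at h; linarith

theorem exists_dualFeasible {τ : Fin N → Fin M} (hτ : IsMinStrategy A τ) (j₀ : Fin N) :
    ∃ s, DualFeasible A B τ s j₀ := by
  obtain ⟨s, hs⟩ := (Set.finite_range fun p : Fin N × Fin N =>
    (B (τ p.1) p.2).unbotD 0 - (A (τ p.1) p.1).unbotD 0).bddAbove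
  refine ⟨s, fun _ => 0, by simp, fun j l => ?_⟩
  have := hs (Set.mem_range_self (j, l))
  obtain ⟨a, ha⟩ := WithBot.ne_bot_iff_exists.1 (hτ j)
  revert this
  rw [add_zero, zero_add]
  simp only [← ha, WithBot.unbotD_coe]
  cases B (τ j) l with
  | bot => simp
  | coe b => intro h; norm_cast; simp at h; linarith

theorem eventually_lt_div_of_le {u : ℕ → ℝ} {r c a : ℝ} (h : ∀ k : ℕ, k * r + c ≤ u k)
    (har : a < r) : ∀ᶠ k : ℕ in Filter.atTop, a < u k / k := by
  filter_upwards [(tendsto_natCast_atTop_atTop (R := ℝ)).eventually_gt_atTop (-c / (r - a)),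
    Filter.eventually_gt_atTop 0] with k hk hk0
  have hk0' : (0 : ℝ) < k := by exact_mod_cast hk0
  rw [div_lt_iff₀ (sub_pos.2 har)] at hk
  rw [lt_div_iff₀ hk0']
  linarith [h k]

theorem eventually_div_lt_of_le {u : ℕ → ℝ} {s c a : ℝ} (h : ∀ k : ℕ, u k ≤ k * s + c)
    (hsa : s < a) : ∀ᶠ k : ℕ in Filter.atTop, u k / k < a := by
  filter_upwards [eventually_lt_div_of_le (u := fun k => -u k) (r := -s) (c := -c) (a := -a)
    (fun k => by linarith [h k]) (neg_lt_neg hsa)] with k hk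
  rw [neg_div] at hk
  linarith

theorem tendsto_iterate_div [NeZero N] (hA : ∀ j, ∃ i, A i j ≠ ⊥) (hB : ∀ i, ∃ l, B i l ≠ ⊥)
    (j₀ : Fin N) (x : Fin N → ℝ) :
    Filter.Tendsto (fun k : ℕ => ((dynOp A B)^[k] x) j₀ / (k : ℝ)) Filter.atTop
      (nhds (sSup {r | PrimalFeasible A B r j₀})) := by
  have hne : {r | PrimalFeasible A B r j₀}.Nonempty := exists_primalFeasible hB j₀
  have hbdd : BddAbove {r | PrimalFeasible A B r j₀} := by
    choose τ hτ using hA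
    obtain ⟨s, hs⟩ := exists_dualFeasible (B := B) hτ j₀
    obtain ⟨c, hc⟩ := hs.exists_iterate_le hB hτ 0
    refine ⟨s, fun r hr => ?_⟩
    obtain ⟨c', hc'⟩ := PrimalFeasible.exists_le_iterate (fun j => ⟨τ j, hτ j⟩) hr 0
    by_contra! hlt
    obtain ⟨a, ha1, ha2⟩ := exists_between hlt
    obtain ⟨k, hk1, hk2⟩ :=
      ((eventually_lt_div_of_le hc' ha2).and (eventually_div_lt_of_le hc ha1)).exists
    exact lt_asymm hk1 hk2
  refine tendsto_order.2 ⟨fun a ha => ?_, fun a ha => ?_⟩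
  · obtain ⟨r, hr, har⟩ := exists_lt_of_lt_csSup hne ha
    obtain ⟨c, hc⟩ := PrimalFeasible.exists_le_iterate hA hr x
    exact eventually_lt_div_of_le hc har
  · have hn : ¬ PrimalFeasible A B a j₀ := fun h => (le_csSup hbdd h).not_gt ha
    obtain ⟨τ, hτ, δ, hδ, hd⟩ := game_alternative hA a j₀ hn
    obtain ⟨c, hc⟩ := hd.exists_iterate_le hB hτ x
    exact eventually_div_lt_of_le hc (by linarith)

theorem tendsto_cycleTime [NeZero N] (hA : ∀ j, ∃ i, A i j ≠ ⊥) (hB : ∀ i, ∃ l, B i l ≠ ⊥)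
    (j₀ : Fin N) (x : Fin N → ℝ) :
    Filter.Tendsto (fun k : ℕ => ((dynOp A B)^[k] x) j₀ / (k : ℝ)) Filter.atTop
      (nhds (cycleTime (dynOp A B) j₀)) := by
  have : cycleTime (dynOp A B) j₀ = sSup {r | PrimalFeasible A B r j₀} :=
    (tendsto_iterate_div hA hB j₀ 0).limUnder_eq
  rw [this]
  exact tendsto_iterate_div hA hB j₀ x

/-- The strict gap in `game_alternative` is what makes the case of cycle time zero feasible. -/
theorem cycleTime_nonneg_iff [NeZero N] (hA : ∀ j, ∃ i, A i j ≠ ⊥)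
    (hB : ∀ i, ∃ l, B i l ≠ ⊥) (j₀ : Fin N) :
    0 ≤ cycleTime (dynOp A B) j₀ ↔ PrimalFeasible A B 0 j₀ := by
  have hlim := tendsto_cycleTime hA hB j₀ 0
  constructor
  · intro h
    by_contra hn
    obtain ⟨τ, hτ, δ, hδ, hd⟩ := game_alternative hA 0 j₀ hn
    obtain ⟨c, hc⟩ := hd.exists_iterate_le hB hτ 0
    have := le_of_tendsto hlim
      ((eventually_div_lt_of_le hc (a := -δ / 2) (by linarith)).mono fun _ => le_of_lt)
    linarith
  · intro h
    obtain ⟨c, hc⟩ := h.exists_le_iterate hA 0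
    refine le_of_forall_lt fun a ha => ?_
    obtain ⟨b, hab, hb⟩ := exists_between ha
    exact hab.trans_le (ge_of_tendsto hlim
      ((eventually_lt_div_of_le hc hb).mono fun _ => le_of_lt))

end Growth

/-! ### Cycles and potentials -/

/-- Every cycle accessible from the node `a` has negative weight. -/
def NegativeCycles {V : Type*} (w : V → V → WithBot ℝ) (a : V) : Prop :=
  ∀ k x, IsCycle w k x → Accesses w a (x 0) → cycleWeight w k x < 0

theorem negativeCycles_of_potential {V : Type*} {w : V → V → WithBot ℝ} {a : V} {s : ℝ}
    (hs : s < 0) (Y : V → WithBot ℝ) (ha : Y a ≠ ⊥)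
    (hY : ∀ b c, Y b + w b c ≤ Y c + (s : WithBot ℝ)) : NegativeCycles w a := by
  have hstep : ∀ b c, w b c ≠ ⊥ → Y b ≠ ⊥ → Y c ≠ ⊥ := by
    intro b c hw hb hc
    have := hY b c
    rw [hc, WithBot.bot_add, le_bot_iff, WithBot.add_eq_bot] at this
    tauto
  have hacc : ∀ b, Accesses w a b → Y b ≠ ⊥ := by
    intro b hb
    induction hb with
    | refl => exact ha
    | tail _ hw ih => exact hstep _ _ hw ih
  rintro k x ⟨hk, hper, hw⟩ hx
  have hfin : ∀ t ≤ k, Y (x t) ≠ ⊥ := by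
    intro t
    induction t with
    | zero => exact fun _ => hacc _ hx
    | succ t ih => exact fun ht => hstep _ _ (hw t ht) (ih (by omega))
  have hle : cycleWeight w k x ≤
      ∑ t ∈ Finset.range k, ((Y (x (t + 1))).unbotD 0 - (Y (x t)).unbotD 0 + s) := by
    refine Finset.sum_le_sum fun t ht => ?_
    rw [Finset.mem_range] at ht
    have h0 := hY (x t) (x (t + 1))
    obtain ⟨p, hp⟩ := WithBot.ne_bot_iff_exists.1 (hfin t (by omega))
    obtain ⟨q, hq⟩ := WithBot.ne_bot_iff_exists.1 (hfin (t + 1) (by omega))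
    obtain ⟨c, hc⟩ := WithBot.ne_bot_iff_exists.1 (hw t ht)
    rw [← hp, ← hq, ← hc] at h0
    rw [← hp, ← hq, ← hc]
    norm_cast at h0
    simp only [WithBot.unbotD_coe]
    linarith
  rw [Finset.sum_add_distrib, Finset.sum_range_sub (fun t => (Y (x t)).unbotD 0), hper,
    sub_self, zero_add, Finset.sum_const, Finset.card_range, nsmul_eq_mul] at hle
  have : (k : ℝ) * s < 0 := mul_neg_of_pos_of_neg (by exact_mod_cast hk) hs
  linarith

/-- Following from each node a successor for which the inequality holds leads into a cycle of
nonnegative weight. -/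
theorem not_negativeCycles_of_potential {V : Type*} [Finite V] {w : V → V → WithBot ℝ} {a : V}
    (Y : V → WithBot ℝ) (ha : Y a ≠ ⊥)
    (hY : ∀ b, ∃ c, Y b ≤ w b c + Y c) : ¬ NegativeCycles w a := by
  intro hneg
  choose h hh using hY
  have hstep : ∀ b, Y b ≠ ⊥ → w b (h b) ≠ ⊥ ∧ Y (h b) ≠ ⊥ := by
    intro b hb
    rw [← not_or, ← WithBot.add_eq_bot]
    exact fun h' => hb (le_bot_iff.1 (h' ▸ hh b))
  have hfin : ∀ t, Y (h^[t] a) ≠ ⊥ := by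
    intro t
    induction t with
    | zero => exact ha
    | succ t ih => rw [Function.iterate_succ_apply']; exact (hstep _ ih).2
  have hacc : ∀ t, Accesses w a (h^[t] a) := by
    intro t
    induction t with
    | zero => exact Relation.ReflTransGen.refl
    | succ t ih =>
      rw [Function.iterate_succ_apply']
      exact Relation.ReflTransGen.tail ih (hstep _ (hfin t)).1
  obtain ⟨p, q, hpq, hper⟩ : ∃ p q, p < q ∧ h^[p] a = h^[q] a := by
    obtain ⟨p, q, hne, heq⟩ := Finite.exists_ne_map_eq_of_infinite fun t : ℕ => h^[t] a
    rcases hne.lt_or_gt with hlt | hlt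
    · exact ⟨p, q, hlt, heq⟩
    · exact ⟨q, p, hlt, heq.symm⟩
  have hlt := hneg (q - p) (fun t => h^[p + t] a)
    ⟨by omega, by simp only [add_zero]; rw [Nat.add_sub_cancel' hpq.le, hper], fun t _ => by
      beta_reduce
      rw [← add_assoc, Function.iterate_succ_apply']; exact (hstep _ (hfin _)).1⟩ (hacc _)
  have hge : ∑ t ∈ Finset.range (q - p),
      ((Y (h^[p + t] a)).unbotD 0 - (Y (h^[p + (t + 1)] a)).unbotD 0) ≤
      cycleWeight w (q - p) (fun t => h^[p + t] a) := by
    refine Finset.sum_le_sum fun t _ => ?_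
    have h0 := hh (h^[p + t] a)
    obtain ⟨c, hc⟩ := WithBot.ne_bot_iff_exists.1 (hstep _ (hfin (p + t))).1
    beta_reduce
    rw [← add_assoc, Function.iterate_succ_apply']
    obtain ⟨y, hy⟩ := WithBot.ne_bot_iff_exists.1 (hfin (p + t))
    obtain ⟨z, hz⟩ := WithBot.ne_bot_iff_exists.1 (hstep _ (hfin (p + t))).2
    rw [← hc, ← hy, ← hz] at h0
    rw [← hc, ← hy, ← hz]
    norm_cast at h0
    simp only [WithBot.unbotD_coe]
    linarith
  rw [Finset.sum_range_sub' (fun t => (Y (h^[p + t] a)).unbotD 0), Nat.add_sub_cancel' hpq.le,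
    add_zero, hper, sub_self] at hge
  exact hge.not_gt hlt

section Strategies

variable {M N : ℕ} {A B : Matrix (Fin M) (Fin N) (WithBot ℝ)} {τ : Fin N → Fin M}

theorem restrictMin_self (j : Fin N) : restrictMin A τ (τ j) j = A (τ j) j := by
  simp [restrictMin]

theorem restrictMin_of_ne {i : Fin M} {j : Fin N} (h : i ≠ τ j) : restrictMin A τ i j = ⊥ := by
  simp [restrictMin, h]

theorem DualFeasible.negativeCycles {s : ℝ} (hs : s < 0) {j₀ : Fin N}
    (hd : DualFeasible A B τ s j₀) :
    NegativeCycles (gameDigraph (restrictMin A τ) B) (Sum.inl j₀) := by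
  classical
  obtain ⟨y, hy0, hy⟩ := hd
  -- The bound `s` on the payment of a round is split equally between its two arcs.
  let Z : Fin M → WithBot ℝ := fun i => Finset.univ.sup fun j =>
    y j + (restrictMin A τ i j).map fun a : ℝ => -a
  have hle : ∀ i j, (y j + (restrictMin A τ i j).map fun a : ℝ => -a) ≤ Z i := fun i j =>
    Finset.le_sup (f := fun j => y j + (restrictMin A τ i j).map fun a : ℝ => -a)
      (Finset.mem_univ j)
  have hZ : ∀ i l, Z i + B i l ≤ y l + (s : WithBot ℝ) := by
    intro i l
    rcases (Finset.univ : Finset (Fin N)).eq_empty_or_nonempty with he | hne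
    · exact absurd (Finset.mem_univ j₀) (by simp [he])
    obtain ⟨j, -, hj⟩ := Finset.exists_mem_eq_sup Finset.univ hne
      (fun j => y j + (restrictMin A τ i j).map fun a : ℝ => -a)
    change Z i = _ at hj
    rw [hj]
    by_cases hi : i = τ j
    · subst hi
      have h0 := hy j l
      rw [restrictMin_self]
      revert h0
      cases A (τ j) j with
      | bot => simp
      | coe a =>
        cases B (τ j) l with
        | bot => simp
        | coe b =>
          cases y j with
          | bot => simp
          | coe η =>
            cases y l with
            | bot => intro h'; rw [WithBot.add_bot, ← WithBot.coe_add] at h'; simp at h'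
            | coe ζ =>
              intro h'
              rw [WithBot.map_coe]
              norm_cast at h' ⊢
              linarith
    · rw [restrictMin_of_ne hi]; simp
  refine negativeCycles_of_potential (s := s / 2) (by linarith)
    (Sum.elim y fun i => Z i + ((-(s / 2) : ℝ) : WithBot ℝ)) hy0 ?_
  rintro (j | i) (l | k)
  · simp [gameDigraph]
  · simp only [gameDigraph, Sum.elim_inl, Sum.elim_inr]
    rw [add_assoc, ← WithBot.coe_add, neg_add_cancel]
    simpa using hle k j
  · simp only [gameDigraph, Sum.elim_inl, Sum.elim_inr]
    calc Z i + ((-(s / 2) : ℝ) : WithBot ℝ) + B i l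
        = Z i + B i l + ((-(s / 2) : ℝ) : WithBot ℝ) := by ac_rfl
      _ ≤ y l + s + ((-(s / 2) : ℝ) : WithBot ℝ) := add_le_add (hZ i l) le_rfl
      _ = y l + ((s / 2 : ℝ) : WithBot ℝ) := by
        rw [add_assoc, ← WithBot.coe_add]; congr 2; ring
  · simp [gameDigraph]

theorem PrimalFeasible.not_negativeCycles (hτ : IsMinStrategy A τ) {j₀ : Fin N}
    (hp : PrimalFeasible A B 0 j₀) :
    ¬ NegativeCycles (gameDigraph (restrictMin A τ) B) (Sum.inl j₀) := by
  have : NeZero N := ⟨fun h => (h ▸ j₀).elim0⟩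
  obtain ⟨y, hy0, hy⟩ := hp
  -- The solution is extended to a node of Max by the best value among its successors.
  refine not_negativeCycles_of_potential (Sum.elim y fun i => tropDot (B i) y) hy0 ?_
  rintro (j | i)
  · refine ⟨Sum.inr (τ j), ?_⟩
    simp only [gameDigraph, Sum.elim_inl, Sum.elim_inr, restrictMin_self]
    obtain ⟨a, ha⟩ := WithBot.ne_bot_iff_exists.1 (hτ j)
    have h0 := hy j (τ j)
    rw [← ha] at h0 ⊢
    calc y j = ((-a : ℝ) : WithBot ℝ) + ((a : WithBot ℝ) + y j + ((0 : ℝ) : WithBot ℝ)) := by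
          rw [WithBot.coe_zero, add_zero, ← add_assoc, ← WithBot.coe_add]; simp
      _ ≤ _ := by rw [WithBot.map_coe]; gcongr
  · obtain ⟨l, hl⟩ := exists_tropDot_eq (B i) y
    exact ⟨Sum.inl l, hl.le⟩

theorem IsMinStrategy.restrictMin_column (hτ : IsMinStrategy A τ) (j : Fin N) :
    ∃ i, restrictMin A τ i j ≠ ⊥ :=
  ⟨τ j, by rw [restrictMin_self]; exact hτ j⟩

theorem negativeCycles_of_cycleTime_neg [NeZero N] (hτ : IsMinStrategy A τ)
    (hB : ∀ i, ∃ l, B i l ≠ ⊥) {j₀ : Fin N}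
    (h : cycleTime (dynOp (restrictMin A τ) B) j₀ < 0) :
    NegativeCycles (gameDigraph (restrictMin A τ) B) (Sum.inl j₀) := by
  have hn := mt (cycleTime_nonneg_iff hτ.restrictMin_column hB j₀).2 h.not_ge
  obtain ⟨τ', hτ', δ, hδ, y, hy0, hy⟩ := game_alternative hτ.restrictMin_column 0 j₀ hn
  -- In the restricted game, `τ` is the only strategy of Min.
  have heq : τ' = τ := by
    funext j
    by_contra hne
    exact hτ' j (restrictMin_of_ne hne)
  subst heq
  refine DualFeasible.negativeCycles (s := 0 - δ) (by linarith) ⟨y, hy0, fun j l => ?_⟩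
  simpa only [restrictMin_self] using hy j l

end Strategies

/-! ### The parametric game -/

section Parametric

variable {m n : ℕ} {C D : Matrix (Fin m) (Fin (n + 1)) (WithBot ℝ)}
  {u v : Fin (n + 1) → WithBot ℝ}

theorem matU_column (hU : ∀ j, u j ≠ ⊥ ∨ ∃ i, C i j ≠ ⊥) (j : Fin (n + 1)) :
    ∃ i, matU C u i j ≠ ⊥ := by
  rcases hU j with h | ⟨i, h⟩
  · exact ⟨Fin.last m, by simpa [matU] using h⟩
  · exact ⟨i.castSucc, by simpa [matU] using h⟩

theorem matV_row (hD : ∀ i, ∃ j, D i j ≠ ⊥) (hv : ∃ j, v j ≠ ⊥) (lam : ℝ) (i : Fin (m + 1)) :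
    ∃ j, matV D v lam i j ≠ ⊥ := by
  refine Fin.lastCases ?_ (fun i => ?_) i
  · simpa [matV] using hv
  · simpa [matV] using hD i

theorem feasible_iff_primalFeasible (lam : ℝ) :
    Feasible C D u v lam ↔ PrimalFeasible (matU C u) (matV D v lam) 0 (Fin.last n) := by
  have hlast : ∀ y, tropDot (matV D v lam (Fin.last m)) y = lam + tropDot v y := by
    intro y
    rw [← tropDot_const_add]
    congr 1
    funext l
    simp [matV]
  have hcast : ∀ i : Fin m, matV D v lam i.castSucc = D i := by
    intro i
    funext l
    simp [matV]
  refine exists_congr fun y => ?_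
  constructor
  · rintro ⟨h1, h2, h3⟩
    refine ⟨h3, fun j i => ?_⟩
    rw [WithBot.coe_zero, add_zero]
    refine Fin.lastCases ?_ (fun i => ?_) i
    · rw [hlast]
      simpa [matU] using tropDot_le_iff.1 h1 j
    · rw [hcast]
      simpa [matU] using tropDot_le_iff.1 (h2 i) j
  · rintro ⟨h3, h⟩
    refine ⟨tropDot_le_iff.2 fun j => ?_, fun i => tropDot_le_iff.2 fun j => ?_, h3⟩
    · rw [← hlast]
      simpa [matU] using h j (Fin.last m)
    · rw [← hcast]
      simpa [matU] using h j i.castSucc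

theorem Feasible.mono {lam lam' : WithBot ℝ} (h : Feasible C D u v lam) (hle : lam ≤ lam') :
    Feasible C D u v lam' := by
  obtain ⟨y, h1, h2, h3⟩ := h
  exact ⟨y, h1.trans (by gcongr), h2, h3⟩

theorem isOptimalValue_iff (lam : ℝ) :
    IsOptimalValue C D u v lam ↔
      Feasible C D u v lam ∧ ∀ μ : ℝ, μ < lam → ¬ Feasible C D u v (μ : WithBot ℝ) := by
  constructor
  · rintro ⟨h1, h2⟩
    exact ⟨h1, fun μ hμ h => (WithBot.coe_lt_coe.2 hμ).not_ge (h2 h)⟩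
  · rintro ⟨h1, h2⟩
    refine ⟨h1, fun μ (hμ : Feasible C D u v μ) => ?_⟩
    cases μ with
    | bot => exact absurd (hμ.mono bot_le) (h2 (lam - 1) (by linarith))
    | coe μ => exact WithBot.coe_le_coe.2 (le_of_not_gt fun h => h2 μ h hμ)

variable {τ : Fin (n + 1) → Fin (m + 1)}

theorem strategyDigraph_eq_add (lam μ : ℝ) (a b : Fin (n + 1) ⊕ Fin (m + 1)) :
    strategyDigraph C D u v τ μ a b = strategyDigraph C D u v τ lam a b +
      ((if a = Sum.inr (Fin.last m) then μ - lam else 0 : ℝ) : WithBot ℝ) := by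
  rcases a with j | i <;> rcases b with l | k
  · simp [strategyDigraph, gameDigraph]
  · simp [strategyDigraph, gameDigraph]
  · refine Fin.lastCases ?_ (fun i => ?_) i
    · simp only [strategyDigraph, gameDigraph, matV, Matrix.of_apply, Fin.snoc_last, if_true]
      cases v l with
      | bot => simp
      | coe b => norm_cast; ring
    · have : i.castSucc ≠ Fin.last m := (Fin.castSucc_lt_last i).ne
      simp [strategyDigraph, gameDigraph, matV, this]
  · simp [strategyDigraph, gameDigraph]

theorem strategyDigraph_ne_bot_iff (lam μ : ℝ) (a b : Fin (n + 1) ⊕ Fin (m + 1)) :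
    strategyDigraph C D u v τ μ a b ≠ ⊥ ↔ strategyDigraph C D u v τ lam a b ≠ ⊥ := by
  rw [strategyDigraph_eq_add lam μ, Ne, WithBot.add_eq_bot]
  simp

theorem accesses_strategyDigraph_iff (lam μ : ℝ) (a b : Fin (n + 1) ⊕ Fin (m + 1)) :
    Accesses (strategyDigraph C D u v τ μ) a b ↔
      Accesses (strategyDigraph C D u v τ lam) a b := by
  unfold Accesses
  simp only [strategyDigraph_ne_bot_iff lam μ]

theorem isCycle_strategyDigraph_iff (lam μ : ℝ) (k : ℕ) (x : ℕ → Fin (n + 1) ⊕ Fin (m + 1)) :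
    IsCycle (strategyDigraph C D u v τ μ) k x ↔
      IsCycle (strategyDigraph C D u v τ lam) k x := by
  unfold IsCycle
  simp only [strategyDigraph_ne_bot_iff lam μ]

/-- The weight of a cycle is affine in the parameter, with slope the number of its passages
through the last node of Max. -/
theorem cycleWeight_strategyDigraph (lam μ : ℝ) {k : ℕ} {x : ℕ → Fin (n + 1) ⊕ Fin (m + 1)}
    (hx : IsCycle (strategyDigraph C D u v τ lam) k x) :
    cycleWeight (strategyDigraph C D u v τ μ) k x =
      cycleWeight (strategyDigraph C D u v τ lam) k x +
        ((Finset.range k).filter fun t => x t = Sum.inr (Fin.last m)).card * (μ - lam) := by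
  rw [cycleWeight, cycleWeight, ← nsmul_eq_mul, ← Finset.sum_const, Finset.sum_filter,
    ← Finset.sum_add_distrib]
  refine Finset.sum_congr rfl fun t ht => ?_
  obtain ⟨c, hc⟩ := WithBot.ne_bot_iff_exists.1 (hx.2.2 t (Finset.mem_range.1 ht))
  rw [strategyDigraph_eq_add lam μ, ← hc, ← WithBot.coe_add]
  simp only [WithBot.unbotD_coe]

theorem Certificate.negativeCycles {lam μ : ℝ} (hc : Certificate C D u v τ lam) (hμ : μ < lam) :
    NegativeCycles (strategyDigraph C D u v τ μ) (Sum.inl (Fin.last n)) := by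
  intro k x hx hacc
  rw [isCycle_strategyDigraph_iff lam μ] at hx
  rw [accesses_strategyDigraph_iff lam μ] at hacc
  rw [cycleWeight_strategyDigraph lam μ hx]
  have hμ' : μ - lam < 0 := sub_neg.2 hμ
  rcases (hc.1 k x hx hacc).lt_or_eq with hlt | heq
  · exact add_neg_of_neg_of_nonpos hlt
      (mul_nonpos_of_nonneg_of_nonpos (Nat.cast_nonneg _) hμ'.le)
  · obtain ⟨t, ht, hxt⟩ := hc.2 k x hx hacc heq
    rw [heq, zero_add]
    refine mul_neg_of_pos_of_neg ?_ hμ'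
    rw [Nat.cast_pos, Finset.card_pos]
    exact ⟨t, by simp [ht, hxt]⟩

/-- As the weights of cycles are affine in the parameter, negativity to the left of `lam` gives
nonpositivity at `lam`, and a zero weight at `lam` forces a positive slope. -/
theorem certificate_of_frequently {lam : ℝ}
    (h : ∃ᶠ μ in nhdsWithin lam (Set.Iio lam),
      NegativeCycles (strategyDigraph C D u v τ μ) (Sum.inl (Fin.last n))) :
    Certificate C D u v τ lam := by
  have hfreq : ∀ k x, IsCycle (strategyDigraph C D u v τ lam) k x →
      Accesses (strategyDigraph C D u v τ lam) (Sum.inl (Fin.last n)) (x 0) →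
      ∃ᶠ μ in nhdsWithin lam (Set.Iio lam),
        cycleWeight (strategyDigraph C D u v τ lam) k x +
        ((Finset.range k).filter fun t => x t = Sum.inr (Fin.last m)).card * (μ - lam) < 0 := by
    intro k x hx hacc
    refine h.mono fun μ hμ => ?_
    rw [← cycleWeight_strategyDigraph lam μ hx]
    exact hμ k x ((isCycle_strategyDigraph_iff lam μ k x).2 hx)
      ((accesses_strategyDigraph_iff lam μ _ _).2 hacc)
  refine ⟨fun k x hx hacc => ?_, fun k x hx hacc h0 => ?_⟩
  · by_contra! hpos
    have hcont : Filter.Tendsto (fun μ : ℝ => cycleWeight (strategyDigraph C D u v τ lam) k x +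
        ((Finset.range k).filter fun t => x t = Sum.inr (Fin.last m)).card * (μ - lam))
        (nhdsWithin lam (Set.Iio lam))
        (nhds (cycleWeight (strategyDigraph C D u v τ lam) k x +
        ((Finset.range k).filter fun t => x t = Sum.inr (Fin.last m)).card * (lam - lam))) :=
      (Continuous.tendsto (by fun_prop) lam).mono_left nhdsWithin_le_nhds
    rw [sub_self, mul_zero, add_zero] at hcont
    exact hfreq k x hx hacc ((hcont.eventually_const_lt hpos).mono fun _ h' => not_lt.2 h'.le)
  · obtain ⟨μ, hμ⟩ := (hfreq k x hx hacc).exists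
    by_contra! hno
    rw [h0, Finset.filter_eq_empty_iff.2 fun t ht => hno t (Finset.mem_range.1 ht)] at hμ
    simp at hμ

end Parametric

end TropLFP

theorem mainTheorem1 {m n : ℕ} (C D : Matrix (Fin m) (Fin (n + 1)) (WithBot ℝ))
    (u v : Fin (n + 1) → WithBot ℝ)
    (hD : ∀ i, ∃ j, D i j ≠ ⊥) (hv : ∃ j, v j ≠ ⊥)
    (hU : ∀ j, u j ≠ ⊥ ∨ ∃ i, C i j ≠ ⊥) :
    -- the limits that define the spectral functions exist and do not depend on the initial vector
    (∀ (lam : ℝ) (x : Fin (n + 1) → ℝ),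
      Filter.Tendsto (fun k : ℕ => ((TropLFP.specOp C D u v lam)^[k] x) (Fin.last n) / (k : ℝ))
        Filter.atTop (nhds (TropLFP.specFun C D u v lam))) ∧
    (∀ τ : Fin (n + 1) → Fin (m + 1), TropLFP.IsMinStrategy (TropLFP.matU C u) τ →
      ∀ (lam : ℝ) (x : Fin (n + 1) → ℝ),
      Filter.Tendsto
        (fun k : ℕ => ((TropLFP.specOpMin C D u v τ lam)^[k] x) (Fin.last n) / (k : ℝ))
        Filter.atTop (nhds (TropLFP.specFunMin C D u v τ lam))) ∧
    -- the certificate of optimality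
    (∀ lam : ℝ,
      (TropLFP.IsOptimalValue C D u v (lam : WithBot ℝ) ↔
        0 ≤ TropLFP.specFun C D u v lam ∧
        ∃ τ : Fin (n + 1) → Fin (m + 1), TropLFP.IsMinStrategy (TropLFP.matU C u) τ ∧
          TropLFP.Certificate C D u v τ lam) ∧
      (TropLFP.IsOptimalValue C D u v (lam : WithBot ℝ) →
        ∀ τ : Fin (n + 1) → Fin (m + 1), TropLFP.IsMinStrategy (TropLFP.matU C u) τ →
          TropLFP.IsLeftOptimal C D u v τ lam → TropLFP.Certificate C D u v τ lam)) := by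
  open TropLFP in
  have hA : ∀ j, ∃ i, matU C u i j ≠ ⊥ := matU_column hU
  have hB : ∀ lam : ℝ, ∀ i, ∃ j, matV D v lam i j ≠ ⊥ := matV_row hD hv
  have hφ : ∀ lam : ℝ, 0 ≤ specFun C D u v lam ↔ Feasible C D u v lam := fun lam => by
    rw [feasible_iff_primalFeasible]
    exact cycleTime_nonneg_iff hA (hB lam) _
  refine ⟨fun lam x => tendsto_cycleTime hA (hB lam) _ x,
    fun τ hτ lam x => tendsto_cycleTime hτ.restrictMin_column (hB lam) _ x,
    fun lam => ⟨?_, ?_⟩⟩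
  · rw [isOptimalValue_iff, hφ]
    refine and_congr_right fun _ => ⟨fun hopt => ?_, ?_⟩
    · have hev : ∀ᶠ μ in nhdsWithin lam (Set.Iio lam), ∃ τ, IsMinStrategy (matU C u) τ ∧
          NegativeCycles (strategyDigraph C D u v τ μ) (Sum.inl (Fin.last n)) := by
        filter_upwards [self_mem_nhdsWithin] with μ hμ
        have hn := hopt μ hμ
        rw [feasible_iff_primalFeasible] at hn
        obtain ⟨τ, hτ, δ, hδ, hd⟩ := game_alternative hA 0 _ hn
        exact ⟨τ, hτ, hd.negativeCycles (by linarith)⟩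
      -- Min has finitely many positional strategies, so one of them serves parameters
      -- arbitrarily close to `lam`.
      by_contra! hno
      have hall : ∀ τ, ∀ᶠ μ in nhdsWithin lam (Set.Iio lam), ¬ (IsMinStrategy (matU C u) τ ∧
          NegativeCycles (strategyDigraph C D u v τ μ) (Sum.inl (Fin.last n))) := by
        intro τ
        rw [← Filter.not_frequently]
        intro hf
        obtain ⟨_, hτ, _⟩ := hf.exists
        exact hno τ hτ (certificate_of_frequently (hf.mono fun _ => And.right))
      obtain ⟨μ, ⟨τ, hτ⟩, hμ⟩ := (hev.and (Filter.eventually_all.2 hall)).exists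
      exact hμ τ hτ
    · rintro ⟨τ, hτ, hc⟩ μ hμ hf
      rw [feasible_iff_primalFeasible] at hf
      exact hf.not_negativeCycles hτ (hc.negativeCycles hμ)
  · rintro hopt τ hτ ⟨ε, hε, hleft⟩
    rw [isOptimalValue_iff] at hopt
    refine certificate_of_frequently (Filter.Eventually.frequently ?_)
    filter_upwards [Ioo_mem_nhdsLT (sub_lt_self lam hε)] with μ hμ
    refine negativeCycles_of_cycleTime_neg hτ (hB μ) ?_
    change specFunMin C D u v τ μ < 0
    rw [← hleft μ ⟨hμ.1.le, hμ.2.le⟩, ← not_le, hφ]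
    exact hopt.2 μ hμ.2
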